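/- For a map $u=(u_1,u_2)$ write $Du=(D_iu_\alpha)_{\alpha i}$ for its gradient matrix, $|Du|^2=\sum_{\alpha,i}(D_iu_\alpha)^2$, and $[Du]^\perp$ for the orthogonal projection of $\mathbb R^2$ onto the nullspace of $(Du)^\top$. Let $\Omega\subseteq\mathbb R^2$ be open and let $u:\Omega\to\mathbb R^2$ be an $\infty$-harmonic map, that is, a map $u\in C^2(\Omega)^2$ such that $$\sum_{i,j,\beta=1}^{2} D_iu_\alpha\,D_ju_\beta\,D^2_{ij}u_\beta+|Du|^2\sum_{\beta,i=1}^{2}[Du]^\perp_{\alpha\beta}\,D^2_{ii}u_\beta=0\quad\text{in }\Omega,\qquad \alpha=1,2 .$$ Let $\Omega'\Subset\Omega$, i.e. $\Omega'\subseteq\mathbb R^2$ is a set whose closure is compact and contained in $\Omega$. Then $u(\Omega')$ is contained in the closed convex hull of the boundary values: $$u(\Omega')\subseteq\overline{\mathrm{co}}\,\big(u(\partial\Omega')\big).$$ Equivalently, every one-dimensional projection of $u$ satisfies the maximum principle: if $\Omega'\neq\emptyset$, then for every $\eta\in\mathbb R^2$ with $|\eta|=1$ the maximum of $\eta^\top u$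 over $\partial\Omega'$ is attained and $$\sup_{\Omega'}\eta^\top u\le\max_{\partial\Omega'}\eta^\top u .$$ -/

import Mathlib

/-- The partial derivative `D_i u` of a map `u : ℝⁿ → ℝᴺ` at `x`, a vector of `ℝᴺ`: its
coordinates `D_i u_α` form the `i`-th column of the gradient matrix `Du(x)`. -/
noncomputable def partialD {n N : ℕ} (i : Fin n)
    (u : EuclideanSpace ℝ (Fin n) → EuclideanSpace ℝ (Fin N))
    (x : EuclideanSpace ℝ (Fin n)) : EuclideanSpace ℝ (Fin N) :=
  fderiv ℝ u x (EuclideanSpace.single i 1)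

/-- The squared Euclidean (Frobenius) norm `|Du(x)|² = ∑_{α,i} (D_i u_α(x))²` of the gradient
matrix. -/
noncomputable def gradNormSq {n N : ℕ}
    (u : EuclideanSpace ℝ (Fin n) → EuclideanSpace ℝ (Fin N))
    (x : EuclideanSpace ℝ (Fin n)) : ℝ :=
  ∑ α : Fin N, ∑ i : Fin n, (partialD i u x α) ^ 2

/-- `[Du(x)]^⊥`: the orthogonal projection of `ℝᴺ` onto the nullspace of `Du(x)ᵀ`. -/
noncomputable def normalProj {n N : ℕ}
    (u : EuclideanSpace ℝ (Fin n) → EuclideanSpace ℝ (Fin N))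
    (x : EuclideanSpace ℝ (Fin n)) :
    EuclideanSpace ℝ (Fin N) →L[ℝ] EuclideanSpace ℝ (Fin N) :=
  (LinearMap.ker (ContinuousLinearMap.adjoint (fderiv ℝ u x)).toLinearMap).starProjection

/-- The `∞`-Laplacian `Δ_∞ u = (Du ⊗ Du + |Du|² [Du]^⊥ ⊗ I) : D²u`, that is
`(Δ_∞ u)_α = D_i u_α D_j u_β D²_{ij} u_β + |Du|² [Du]^⊥_{αβ} D²_{ii} u_β` (repeated indices are
summed). -/
noncomputable def infLaplacian {n N : ℕ}
    (u : EuclideanSpace ℝ (Fin n) → EuclideanSpace ℝ (Fin N))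
    (x : EuclideanSpace ℝ (Fin n)) : EuclideanSpace ℝ (Fin N) :=
  (∑ i : Fin n, ∑ j : Fin n,
      (∑ β : Fin N, partialD j u x β * partialD i (partialD j u) x β) • partialD i u x) +
    gradNormSq u x • normalProj u x (∑ i : Fin n, partialD i (partialD i u) x)

/-- `u` is an `∞`-harmonic map on the open set `Ω`: a classical, i.e. `C²(Ω)`, solution of
`Δ_∞ u = 0` in `Ω`. The values of `u` outside of `Ω` are irrelevant. -/
structure IsInfHarmonic {n N : ℕ} (Ω : Set (EuclideanSpace ℝ (Fin n)))
    (u : EuclideanSpace ℝ (Fin n) → EuclideanSpace ℝ (Fin N)) : Prop where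
  contDiffOn : ContDiffOn ℝ 2 u Ω
  infLaplacian_eq_zero : ∀ x ∈ Ω, infLaplacian u x = 0

/-! The tangential part of the system says that `|Du|²` is stationary along the range of `(Du)ᵀ`, so
flows of the fields `(Du)ᵀ ξ` stay in a level set of `|Du|²`. The normal part says that `n · Δu = 0`
whenever `(Du)ᵀ n = 0` and `Du ≠ 0`.

The core is `gradNormSq_eq_zero_of_constrained_max`. Suppose `‖u - q‖²` has a local maximum at `x`
on the level set of `|Du|²`, with `Du x ≠ 0`, and put `n = u x - q`. The flow of `(Du)ᵀ n` forces
`(Du)ᵀ n = 0` at `x`, and a second variation along a flow with velocity `a` at `x` gives `n ·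
D²u(a,a) < 0`. Since `n · Δu = 0`, the direction `τ ⟂ a` has `n · D²u(τ,τ) > 0`. This makes `Du`
invertible on a short ray from `x` along `τ`, so `|Du|²` is constant on the ray, and the second
variation along it contradicts maximality.

For `inner_le_of_frontier`, a violation of the bound yields an interior point `x₁` with `Du x₁ ≠ 0`
where the bound still fails. On the level set of `|Du|²` through `x₁`, the distance of `u` to a
remote centre `-Rη` is maximised in the interior, which the core excludes. Hahn–Banach turns these
half-plane bounds into the convex hull statement. -/

/-- The gradient of the scalar function `⟪ξ, u⟫`, that is `(Du)ᵀ ξ`. -/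
noncomputable def projGradient
    (u : EuclideanSpace ℝ (Fin 2) → EuclideanSpace ℝ (Fin 2)) (ξ x : EuclideanSpace ℝ (Fin 2)) :
    EuclideanSpace ℝ (Fin 2) :=
  ∑ i : Fin 2, inner ℝ ξ (fderiv ℝ u x (EuclideanSpace.single i 1)) • EuclideanSpace.single i 1

lemma sum_apply_smul_single (d : EuclideanSpace ℝ (Fin 2)) :
    ∑ i : Fin 2, d i • (EuclideanSpace.single i 1 : EuclideanSpace ℝ (Fin 2)) = d := by
  ext j
  fin_cases j <;> simp [Fin.sum_univ_two]

lemma projGradient_apply (u : EuclideanSpace ℝ (Fin 2) → EuclideanSpace ℝ (Fin 2))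
    (ξ x : EuclideanSpace ℝ (Fin 2)) (i : Fin 2) :
    projGradient u ξ x i = inner ℝ ξ (fderiv ℝ u x (EuclideanSpace.single i 1)) := by
  fin_cases i <;> simp [projGradient, Fin.sum_univ_two]

lemma inner_projGradient (u : EuclideanSpace ℝ (Fin 2) → EuclideanSpace ℝ (Fin 2))
    (ξ x d : EuclideanSpace ℝ (Fin 2)) :
    inner ℝ (projGradient u ξ x) d = inner ℝ ξ (fderiv ℝ u x d) := by
  conv_rhs => rw [← sum_apply_smul_single d]
  simp only [map_sum, map_smul, inner_sum, inner_smul_right, PiLp.inner_apply (projGradient u ξ x),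
    projGradient_apply]
  simp

lemma adjoint_fderiv_apply (u : EuclideanSpace ℝ (Fin 2) → EuclideanSpace ℝ (Fin 2))
    (ξ x : EuclideanSpace ℝ (Fin 2)) :
    ContinuousLinearMap.adjoint (fderiv ℝ u x) ξ = projGradient u ξ x := by
  refine ext_inner_right ℝ fun d => ?_
  rw [ContinuousLinearMap.adjoint_inner_left, inner_projGradient]

lemma gradNormSq_eq (u : EuclideanSpace ℝ (Fin 2) → EuclideanSpace ℝ (Fin 2))
    (x : EuclideanSpace ℝ (Fin 2)) :
    gradNormSq u x = ∑ i : Fin 2, ‖fderiv ℝ u x (EuclideanSpace.single i 1)‖ ^ 2 := by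
  simp only [gradNormSq, partialD, EuclideanSpace.real_norm_sq_eq]
  exact Finset.sum_comm

lemma gradNormSq_eq_zero_iff (u : EuclideanSpace ℝ (Fin 2) → EuclideanSpace ℝ (Fin 2))
    (x : EuclideanSpace ℝ (Fin 2)) : gradNormSq u x = 0 ↔ fderiv ℝ u x = 0 := by
  constructor
  · intro h
    rw [gradNormSq_eq, Finset.sum_eq_zero_iff_of_nonneg (fun _ _ => by positivity)] at h
    ext1 d
    rw [← sum_apply_smul_single d]
    simp only [map_sum, map_smul, zero_apply, smul_zero,
      Finset.sum_const_zero]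
    refine Finset.sum_eq_zero fun i hi => ?_
    simpa using Or.inr (h i hi)
  · intro h
    simp [gradNormSq_eq, h]

/-! ### Tangential and normal parts of the `∞`-Laplace system -/

section Smooth

variable {u : EuclideanSpace ℝ (Fin 2) → EuclideanSpace ℝ (Fin 2)} {x : EuclideanSpace ℝ (Fin 2)}

lemma contDiffAt_one_fderiv (hu : ContDiffAt ℝ 2 u x) : ContDiffAt ℝ 1 (fderiv ℝ u) x :=
  hu.fderiv_right (by norm_num)

lemma hasFDerivAt_fderiv_of_contDiffAt (hu : ContDiffAt ℝ 2 u x) :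
    HasFDerivAt (fderiv ℝ u) (fderiv ℝ (fderiv ℝ u) x) x :=
  ((contDiffAt_one_fderiv hu).differentiableAt (by norm_num)).hasFDerivAt

lemma contDiffAt_projGradient (hu : ContDiffAt ℝ 2 u x)
    (ξ : EuclideanSpace ℝ (Fin 2)) : ContDiffAt ℝ 1 (projGradient u ξ) x := by
  unfold projGradient
  refine ContDiffAt.sum fun i _ => ContDiffAt.fun_smul ?_ contDiffAt_const
  exact contDiffAt_const.inner ℝ ((contDiffAt_one_fderiv hu).clm_apply contDiffAt_const)

lemma hasFDerivAt_gradNormSq (hu : ContDiffAt ℝ 2 u x) :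
    HasFDerivAt (gradNormSq u) (fderiv ℝ (gradNormSq u) x) x := by
  have h : gradNormSq u
      = fun y => ∑ i : Fin 2, ‖fderiv ℝ u y (EuclideanSpace.single i 1)‖ ^ 2 :=
    funext fun y => gradNormSq_eq u y
  rw [h]
  refine DifferentiableAt.hasFDerivAt (DifferentiableAt.fun_sum fun i _ => ?_)
  exact ((hasFDerivAt_fderiv_of_contDiffAt hu).differentiableAt.clm_apply
    (differentiableAt_const _)).norm_sq ℝ

lemma fderiv_gradNormSq_apply (hu : ContDiffAt ℝ 2 u x)
    (d : EuclideanSpace ℝ (Fin 2)) :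
    fderiv ℝ (gradNormSq u) x d = 2 * ∑ i : Fin 2,
      inner ℝ (fderiv ℝ u x (EuclideanSpace.single i 1))
        (fderiv ℝ (fderiv ℝ u) x d (EuclideanSpace.single i 1)) := by
  have h : gradNormSq u
      = fun y => ∑ i : Fin 2, ‖fderiv ℝ u y (EuclideanSpace.single i 1)‖ ^ 2 :=
    funext fun y => gradNormSq_eq u y
  have h2 := HasFDerivAt.fun_sum (u := Finset.univ) fun (i : Fin 2) _ =>
    ((hasFDerivAt_fderiv_of_contDiffAt hu).clm_apply
      (hasFDerivAt_const (EuclideanSpace.single i (1 : ℝ)) x)).norm_sq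
  rw [h, h2.fderiv]
  simp [Fin.sum_univ_two]
  ring

lemma partialD_partialD (hu : ContDiffAt ℝ 2 u x) (i j : Fin 2) :
    partialD i (partialD j u) x
      = fderiv ℝ (fderiv ℝ u) x (EuclideanSpace.single i 1) (EuclideanSpace.single j 1) := by
  have h := (hasFDerivAt_fderiv_of_contDiffAt hu).clm_apply
    (hasFDerivAt_const (EuclideanSpace.single j (1 : ℝ)) x)
  have h' : partialD j u = fun y => fderiv ℝ u y (EuclideanSpace.single j 1) := rfl
  rw [partialD, h', h.fderiv]
  simp

/-- The `∞`-Laplacian splits as `½ Du(∇|Du|²) + |Du|² [Du]^⊥ Δu`. -/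
lemma infLaplacian_eq (hu : ContDiffAt ℝ 2 u x) :
    infLaplacian u x = (2 : ℝ)⁻¹ • fderiv ℝ u x (∑ i : Fin 2,
        fderiv ℝ (gradNormSq u) x (EuclideanSpace.single i 1) • EuclideanSpace.single i 1)
      + gradNormSq u x • normalProj u x (∑ i : Fin 2,
        fderiv ℝ (fderiv ℝ u) x (EuclideanSpace.single i 1) (EuclideanSpace.single i 1)) := by
  simp only [infLaplacian, partialD_partialD hu, map_sum, map_smul, fderiv_gradNormSq_apply hu]
  congr 1
  rw [Finset.smul_sum]
  refine Finset.sum_congr rfl fun i _ => ?_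
  rw [← Finset.sum_smul, smul_smul, inv_mul_cancel_left₀ two_ne_zero]
  simp [partialD, PiLp.inner_apply, mul_comm]

lemma inner_normalProj (n d : EuclideanSpace ℝ (Fin 2)) (hn : projGradient u n x = 0) :
    inner ℝ n (normalProj u x d) = inner ℝ n d := by
  have hmem : n ∈ LinearMap.ker (ContinuousLinearMap.adjoint (fderiv ℝ u x)).toLinearMap := by
    simpa [adjoint_fderiv_apply] using hn
  rw [normalProj, Submodule.inner_starProjection_left_eq_right _ n d |>.symm,
    Submodule.starProjection_eq_self_iff.mpr hmem]

lemma projGradient_normalProj (d : EuclideanSpace ℝ (Fin 2)) :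
    projGradient u (normalProj u x d) x = 0 := by
  rw [← adjoint_fderiv_apply]
  exact LinearMap.mem_ker.mp (Submodule.starProjection_apply_mem
    (LinearMap.ker (ContinuousLinearMap.adjoint (fderiv ℝ u x)).toLinearMap) d)

/-- `|Du|²` is stationary in the directions of the range of `(Du)ᵀ`. -/
lemma fderiv_gradNormSq_projGradient (hu : ContDiffAt ℝ 2 u x) (h0 : infLaplacian u x = 0)
    (ξ : EuclideanSpace ℝ (Fin 2)) :
    fderiv ℝ (gradNormSq u) x (projGradient u ξ x) = 0 := by
  rw [infLaplacian_eq hu] at h0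
  set grad : EuclideanSpace ℝ (Fin 2) := ∑ i : Fin 2,
    fderiv ℝ (gradNormSq u) x (EuclideanSpace.single i 1) • EuclideanSpace.single i 1 with hgrad
  have hinner (d : EuclideanSpace ℝ (Fin 2)) :
      inner ℝ d grad = fderiv ℝ (gradNormSq u) x d := by
    conv_rhs => rw [← sum_apply_smul_single d]
    simp [hgrad, Fin.sum_univ_two, inner_add_right, inner_smul_right,
      EuclideanSpace.inner_single_right, mul_comm]
  -- The normal term lies in the kernel of `(Du)ᵀ`, hence is orthogonal to the range of `Du`;
  -- pairing the system with `Du grad` leaves only `½ ‖Du grad‖²`.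
  have hT : fderiv ℝ u x grad = 0 := by
    have h1 : inner ℝ (fderiv ℝ u x grad) (fderiv ℝ u x grad) = 0 := by
      have h2 := congrArg (fun z => inner ℝ z (fderiv ℝ u x grad)) h0
      simp only [inner_add_left, inner_smul_left, inner_zero_left, ← inner_projGradient u
        (normalProj u x _), projGradient_normalProj] at h2
      simpa using h2
    exact inner_self_eq_zero.mp h1
  rw [← hinner, inner_projGradient, hT, inner_zero_right]

/-- The normal part of the `∞`-Laplace system. -/
lemma inner_laplacian_eq_zero (hu : ContDiffAt ℝ 2 u x) (h0 : infLaplacian u x = 0)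
    {n : EuclideanSpace ℝ (Fin 2)} (hn : projGradient u n x = 0) (hg : gradNormSq u x ≠ 0) :
    ∑ i : Fin 2, inner ℝ n
      (fderiv ℝ (fderiv ℝ u) x (EuclideanSpace.single i 1) (EuclideanSpace.single i 1)) = 0 := by
  rw [infLaplacian_eq hu] at h0
  have h2 := congrArg (fun z => inner ℝ n z) h0
  simp only [inner_add_right, inner_smul_right, inner_zero_right, inner_normalProj _ _ hn,
    ← inner_projGradient u n, hn, inner_zero_left] at h2
  rw [← inner_sum]
  simpa [hg] using h2

end Smooth

/-! ### One-sided calculus on the real line -/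

section RealLine

open Filter Topology Set

lemma eventually_pos_of_hasDerivAt_pos {f : ℝ → ℝ} {c : ℝ} (hf : HasDerivAt f c 0) (hc : 0 < c) :
    ∀ᶠ t in 𝓝[>] (0 : ℝ), f 0 < f t := by
  have h := (hasDerivAt_iff_tendsto_slope.mp hf).mono_left
    (nhdsWithin_mono 0 (fun t (ht : t ∈ Ioi (0 : ℝ)) => ne_of_gt ht))
  filter_upwards [h.eventually (lt_mem_nhds hc), self_mem_nhdsWithin] with t ht ht0
  have ht0' : (0 : ℝ) < t := ht0
  rw [slope_def_field, sub_zero] at ht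
  have := (div_pos_iff_of_pos_right ht0').mp ht
  linarith

lemma deriv_nonpos_of_eventually_le {f : ℝ → ℝ} {c : ℝ} (hf : HasDerivAt f c 0)
    (hmax : ∀ᶠ t in 𝓝[>] (0 : ℝ), f t ≤ f 0) : c ≤ 0 := by
  by_contra! hc
  obtain ⟨t, h1, h2⟩ := ((eventually_pos_of_hasDerivAt_pos hf hc).and hmax).exists
  exact absurd h1 (not_lt.mpr h2)

lemma exists_Icc_of_eventually {p q : ℝ → Prop} (hp : ∀ᶠ t in 𝓝 (0 : ℝ), p t)
    (hq : ∀ᶠ t in 𝓝[>] (0 : ℝ), q t) :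
    ∃ δ > 0, (∀ t ∈ Icc 0 δ, p t) ∧ ∀ t ∈ Ioc 0 δ, q t := by
  obtain ⟨δ₁, hδ₁, h₁⟩ := Metric.eventually_nhds_iff.mp hp
  obtain ⟨δ₂, hδ₂, h₂⟩ := mem_nhdsGT_iff_exists_Ioc_subset.mp hq
  refine ⟨min (δ₁ / 2) δ₂, lt_min (half_pos hδ₁) hδ₂, fun t ht => h₁ ?_, fun t ht => h₂ ?_⟩
  · rw [Real.dist_eq, sub_zero, abs_of_nonneg ht.1]
    linarith [ht.2.trans (min_le_left _ _)]
  · exact ⟨ht.1, ht.2.trans (min_le_right _ _)⟩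

/-- One-sided second-order necessary condition for a maximum. -/
lemma second_deriv_nonpos_of_eventually_le {φ ψ : ℝ → ℝ} {k : ℝ}
    (hφ : ∀ᶠ t in 𝓝 (0 : ℝ), HasDerivAt φ (ψ t) t) (hψ0 : ψ 0 = 0) (hψ : HasDerivAt ψ k 0)
    (hmax : ∀ᶠ t in 𝓝[>] (0 : ℝ), φ t ≤ φ 0) : k ≤ 0 := by
  by_contra! hk
  obtain ⟨δ, hδ, h₁, h₂⟩ := exists_Icc_of_eventually hφ
    ((eventually_pos_of_hasDerivAt_pos hψ hk).and hmax)
  have hmono : StrictMonoOn φ (Icc 0 δ) := by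
    refine strictMonoOn_of_deriv_pos (convex_Icc 0 δ)
      (fun t ht => (h₁ t ht).continuousAt.continuousWithinAt) fun t ht => ?_
    rw [interior_Icc] at ht
    rw [(h₁ t (Ioo_subset_Icc_self ht)).deriv, ← hψ0]
    exact (h₂ t (Ioo_subset_Ioc_self ht)).1
  exact absurd (hmono ⟨le_rfl, hδ.le⟩ ⟨hδ.le, le_rfl⟩ hδ)
    (not_lt.mpr (h₂ δ ⟨hδ, le_rfl⟩).2)

/-- The derivative need not be controlled at `0` itself: along the ray in direction `τ`,
stationarity of `|Du|²` is known only for `t > 0`. -/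
lemma eventually_eq_of_hasDerivAt_zero {k : ℝ → ℝ} (hc : ContinuousAt k 0)
    (hk : ∀ᶠ t in 𝓝[>] (0 : ℝ), HasDerivAt k 0 t) : ∀ᶠ t in 𝓝[>] (0 : ℝ), k t = k 0 := by
  obtain ⟨δ, hδ, -, h⟩ := exists_Icc_of_eventually (p := fun _ => True) (by simp) hk
  have hcont : ContinuousOn k (Icc 0 δ) := fun t ht => by
    rcases ht.1.eq_or_lt with rfl | ht0
    · exact hc.continuousWithinAt
    · exact (h t ⟨ht0, ht.2⟩).continuousAt.continuousWithinAt
  have hd : ∀ t ∈ interior (Icc 0 δ), HasDerivAt k 0 t := fun t ht => by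
    rw [interior_Icc] at ht
    exact h t (Ioo_subset_Ioc_self ht)
  have hdiff : DifferentiableOn ℝ k (interior (Icc 0 δ)) := fun t ht =>
    (hd t ht).differentiableAt.differentiableWithinAt
  have hmono := monotoneOn_of_deriv_nonneg (convex_Icc 0 δ) hcont hdiff
    fun t ht => (hd t ht).deriv.ge
  have hanti := antitoneOn_of_deriv_nonpos (convex_Icc 0 δ) hcont hdiff
    fun t ht => (hd t ht).deriv.le
  filter_upwards [Ioc_mem_nhdsGT hδ] with t ht
  have h0 : (0 : ℝ) ∈ Icc 0 δ := ⟨le_rfl, hδ.le⟩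
  exact le_antisymm (hanti h0 (Ioc_subset_Icc_self ht) ht.1.le)
    (hmono h0 (Ioc_subset_Icc_self ht) ht.1.le)

end RealLine

/-! ### Constrained maxima of `‖u - q‖²` on level sets of `|Du|²` -/

section ConstrainedMax

open Filter Topology Set

variable {u : EuclideanSpace ℝ (Fin 2) → EuclideanSpace ℝ (Fin 2)} {x : EuclideanSpace ℝ (Fin 2)}

lemma hasDerivAt_norm_sub_sq (hu : ContDiffAt ℝ 2 u x) {γ : ℝ → EuclideanSpace ℝ (Fin 2)}
    {t : ℝ} {γ' : EuclideanSpace ℝ (Fin 2)} (hγ : HasDerivAt γ γ' t) (hx : γ t = x)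
    (q : EuclideanSpace ℝ (Fin 2)) :
    HasDerivAt (fun s => ‖u (γ s) - q‖ ^ 2) (2 * inner ℝ (u x - q) (fderiv ℝ u x γ')) t := by
  subst hx
  have h := (hu.differentiableAt (by norm_num)).hasFDerivAt.comp_hasDerivAt t hγ
  simpa using! (h.sub_const q).norm_sq

/-- The second derivative of `‖u - q‖²` along an integral curve of `X` through a point where
`u - q` is orthogonal to the range of `Du`. -/
lemma hasDerivAt_inner_sub_fderiv (hu : ContDiffAt ℝ 2 u x)
    {X : EuclideanSpace ℝ (Fin 2) → EuclideanSpace ℝ (Fin 2)} (hX : DifferentiableAt ℝ X x)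
    {γ : ℝ → EuclideanSpace ℝ (Fin 2)} (hγ : HasDerivAt γ (X x) 0) (hx : γ 0 = x)
    {q : EuclideanSpace ℝ (Fin 2)} (hq : projGradient u (u x - q) x = 0) :
    HasDerivAt (fun s => 2 * inner ℝ (u (γ s) - q) (fderiv ℝ u (γ s) (X (γ s))))
      (2 * (inner ℝ (u x - q) (fderiv ℝ (fderiv ℝ u) x (X x) (X x))
        + ‖fderiv ℝ u x (X x)‖ ^ 2)) 0 := by
  subst hx
  have h₁ := (hu.differentiableAt (by norm_num)).hasFDerivAt.comp_hasDerivAt 0 hγ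
  have h₂ := (hasFDerivAt_fderiv_of_contDiffAt hu).comp_hasDerivAt 0 hγ
  have h₃ := hX.hasFDerivAt.comp_hasDerivAt 0 hγ
  have h := ((h₁.sub_const q).inner ℝ (h₂.clm_apply h₃)).const_mul 2
  refine h.congr_deriv ?_
  -- The acceleration `DX(X)` of the curve enters only through its image under `Du`, which is
  -- orthogonal to `u - q`.
  have hz : inner ℝ (u (γ 0) - q) (fderiv ℝ u (γ 0) (fderiv ℝ X (γ 0) (X (γ 0)))) = 0 := by
    rw [← inner_projGradient, hq, inner_zero_left]
  simp [inner_add_right, hz]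

/-- If `‖u - q‖²` has a local maximum at `x` relative to the level set of `|Du|²` through `x`,
then `Du x = 0`. -/
theorem gradNormSq_eq_zero_of_constrained_max
    (hu : ∀ᶠ y in 𝓝 x, ContDiffAt ℝ 2 u y ∧ infLaplacian u y = 0) (q : EuclideanSpace ℝ (Fin 2))
    (hmax : ∀ᶠ y in 𝓝 x, gradNormSq u y = gradNormSq u x → ‖u y - q‖ ^ 2 ≤ ‖u x - q‖ ^ 2) :
    gradNormSq u x = 0 := by
  by_contra hg
  have hux := hu.self_of_nhds
  set n := u x - q with hn
  -- Maximality is inherited by curves along which `|Du|²` is stationary.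
  have hcurve : ∀ γ : ℝ → EuclideanSpace ℝ (Fin 2), ∀ γ' : ℝ → EuclideanSpace ℝ (Fin 2), γ 0 = x →
      (∀ᶠ t in 𝓝 (0 : ℝ), HasDerivAt γ (γ' t) t) →
      (∀ᶠ t in 𝓝[>] (0 : ℝ), fderiv ℝ (gradNormSq u) (γ t) (γ' t) = 0) →
      (∀ᶠ t in 𝓝 (0 : ℝ), HasDerivAt (fun s => ‖u (γ s) - q‖ ^ 2)
        (2 * inner ℝ (u (γ t) - q) (fderiv ℝ u (γ t) (γ' t))) t) ∧
      ∀ᶠ t in 𝓝[>] (0 : ℝ), ‖u (γ t) - q‖ ^ 2 ≤ ‖u (γ 0) - q‖ ^ 2 := by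
    intro γ γ' hγ0 hγ hstat
    have hcont : Tendsto γ (𝓝 0) (𝓝 x) := hγ0 ▸ hγ.self_of_nhds.continuousAt.tendsto
    have hγu := hcont.eventually hu
    refine ⟨?_, ?_⟩
    · filter_upwards [hγ, hγu] with t ht hut
      exact hasDerivAt_norm_sub_sq hut.1 ht rfl q
    · have hk : ∀ᶠ t in 𝓝 (0 : ℝ), HasDerivAt (fun s => gradNormSq u (γ s))
          (fderiv ℝ (gradNormSq u) (γ t) (γ' t)) t := by
        filter_upwards [hγ, hγu] with t ht hut
        exact (hasFDerivAt_gradNormSq hut.1).comp_hasDerivAt t ht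
      have hconst := eventually_eq_of_hasDerivAt_zero hk.self_of_nhds.continuousAt (by
        filter_upwards [hk.filter_mono nhdsWithin_le_nhds, hstat] with t ht ht0
        rwa [ht0] at ht)
      filter_upwards [hconst, (hcont.eventually hmax).filter_mono nhdsWithin_le_nhds] with t h1 h2
      rw [hγ0] at h1 ⊢
      exact h2 h1
  -- The integral curves of `(Du)ᵀ ξ` are such curves.
  have hflow : ∀ ξ : EuclideanSpace ℝ (Fin 2), ∃ γ : ℝ → EuclideanSpace ℝ (Fin 2), γ 0 = x ∧
      (∀ᶠ t in 𝓝 (0 : ℝ), HasDerivAt γ (projGradient u ξ (γ t)) t) ∧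
      (∀ᶠ t in 𝓝 (0 : ℝ), HasDerivAt (fun s => ‖u (γ s) - q‖ ^ 2)
        (2 * inner ℝ (u (γ t) - q) (fderiv ℝ u (γ t) (projGradient u ξ (γ t)))) t) ∧
      ∀ᶠ t in 𝓝[>] (0 : ℝ), ‖u (γ t) - q‖ ^ 2 ≤ ‖u (γ 0) - q‖ ^ 2 := by
    intro ξ
    obtain ⟨γ, hγ0, ε, hε, hγ⟩ := (contDiffAt_projGradient hux.1
      ξ).exists_forall_mem_closedBall_exists_eq_forall_mem_Ioo_hasDerivAt₀ 0
    have hγ' : ∀ᶠ t in 𝓝 (0 : ℝ), HasDerivAt γ (projGradient u ξ (γ t)) t := by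
      filter_upwards [Ioo_mem_nhds (show (0 : ℝ) - ε < 0 by linarith)
        (show (0 : ℝ) < 0 + ε by linarith)] with t ht using hγ t ht
    refine ⟨γ, hγ0, hγ', hcurve γ _ hγ0 hγ' (Eventually.filter_mono nhdsWithin_le_nhds ?_)⟩
    have hcont : Tendsto γ (𝓝 0) (𝓝 x) := hγ0 ▸ hγ'.self_of_nhds.continuousAt.tendsto
    filter_upwards [hcont.eventually hu] with t ht
    exact fderiv_gradNormSq_projGradient ht.1 ht.2 ξ
  -- Along the flow of `(Du)ᵀ n` the initial derivative of `‖u - q‖²` is `2 ‖(Du)ᵀ n‖²`.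
  have hn0 : projGradient u n x = 0 := by
    obtain ⟨γ, hγ0, hγ, hφ, hle⟩ := hflow n
    have h := deriv_nonpos_of_eventually_le hφ.self_of_nhds hle
    rw [hγ0, ← hn, ← inner_projGradient, real_inner_self_eq_norm_sq] at h
    have : ‖projGradient u n x‖ ^ 2 = 0 := le_antisymm (by linarith) (by positivity)
    simpa using this
  -- Taking `ξ = Du d` in the range of `Du` makes both `a` and `Du a` nonzero, because `⟪a, d⟫ =
  -- ‖ξ‖²` and `⟪ξ, Du a⟫ = ‖a‖²`.
  obtain ⟨d, hd⟩ : ∃ d, fderiv ℝ u x d ≠ 0 := by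
    by_contra! h
    exact hg ((gradNormSq_eq_zero_iff u x).mpr (by ext1 d; simpa using h d))
  set ξ := fderiv ℝ u x d with hξ
  set a := projGradient u ξ x with ha
  have ha0 : a ≠ 0 := fun h => by
    have := inner_projGradient u ξ x d
    rw [← ha, h, inner_zero_left, ← hξ, eq_comm, inner_self_eq_zero] at this
    exact hd this
  have hFa : 0 < ‖fderiv ℝ u x a‖ := by
    rw [norm_pos_iff]
    intro h
    have := inner_projGradient u ξ x a
    rw [h, inner_zero_right, ← ha, inner_self_eq_zero] at this
    exact ha0 this
  have hD2a : inner ℝ n (fderiv ℝ (fderiv ℝ u) x a a) < 0 := by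
    obtain ⟨γ, hγ0, hγ, hφ, hle⟩ := hflow ξ
    have hψ := hasDerivAt_inner_sub_fderiv hux.1
      ((contDiffAt_projGradient hux.1 ξ).differentiableAt (by norm_num))
      (hγ0 ▸ hγ.self_of_nhds) hγ0 hn0
    have h := second_deriv_nonpos_of_eventually_le hφ
      (by rw [hγ0, ← hn, ← inner_projGradient, hn0, inner_zero_left, mul_zero]) hψ hle
    rw [← ha, ← hn] at h
    nlinarith
  -- The quarter turn of `a`: the values of `n · D²u` on `a` and `τ` add up to `‖a‖² (n · Δu) = 0`.
  set τ : EuclideanSpace ℝ (Fin 2) := !₂[-a 1, a 0] with hτ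
  have hD2τ : 0 < inner ℝ n (fderiv ℝ (fderiv ℝ u) x τ τ) := by
    have hΔ := inner_laplacian_eq_zero hux.1 hux.2 hn0 hg
    have hsum : inner ℝ n (fderiv ℝ (fderiv ℝ u) x a a)
        + inner ℝ n (fderiv ℝ (fderiv ℝ u) x τ τ)
        = (a 0 ^ 2 + a 1 ^ 2) * ∑ i : Fin 2, inner ℝ n (fderiv ℝ (fderiv ℝ u) x
          (EuclideanSpace.single i 1) (EuclideanSpace.single i 1)) := by
      conv_lhs => rw [← sum_apply_smul_single a, ← sum_apply_smul_single τ]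
      simp only [Fin.sum_univ_two, map_add, map_smul, add_apply,
        smul_apply, inner_add_right, inner_smul_right, hτ]
      simp
      ring
    rw [hΔ, mul_zero] at hsum
    linarith
  -- Along the line in direction `τ` the rank of `Du` is two except at `x`.
  have hline : ∀ t : ℝ, HasDerivAt (fun s : ℝ => x + s • τ) τ t := fun t => by
    simpa using! ((hasDerivAt_id t).smul_const τ).const_add x
  have hlinecont : Tendsto (fun s : ℝ => x + s • τ) (𝓝 0) (𝓝 x) := by
    simpa using! (hline 0).continuousAt.tendsto
  have hcoord : ∀ ζ : EuclideanSpace ℝ (Fin 2), ∀ i : Fin 2,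
      HasDerivAt (fun s : ℝ => projGradient u ζ (x + s • τ) i)
        (inner ℝ ζ (fderiv ℝ (fderiv ℝ u) x τ (EuclideanSpace.single i 1))) 0 := by
    intro ζ i
    have h₂ := (show HasFDerivAt (fderiv ℝ u) (fderiv ℝ (fderiv ℝ u) x) (x + (0 : ℝ) • τ) by
      simpa using hasFDerivAt_fderiv_of_contDiffAt hux.1).comp_hasDerivAt 0 (hline 0)
    have h₃ := (hasDerivAt_const (0 : ℝ) ζ).inner ℝ (h₂.clm_apply
      (hasDerivAt_const (0 : ℝ) (EuclideanSpace.single i (1 : ℝ))))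
    simp only [projGradient_apply]
    simpa using! h₃
  -- The determinant of `(Du)ᵀ ξ` and `(Du)ᵀ n` along the line vanishes at `t = 0`, and its
  -- derivative there is `n · D²u(τ,τ) > 0`.
  have hdet := ((hcoord ξ 0).mul (hcoord n 1)).sub ((hcoord ξ 1).mul (hcoord n 0))
  have hne := hdet.eventually_ne (c := 0) (by
    have hT : ∀ T : EuclideanSpace ℝ (Fin 2) →L[ℝ] EuclideanSpace ℝ (Fin 2),
        inner ℝ n (T τ) = a 0 * inner ℝ n (T (EuclideanSpace.single 1 1))
          - a 1 * inner ℝ n (T (EuclideanSpace.single 0 1)) := by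
      intro T
      conv_lhs => rw [← sum_apply_smul_single τ]
      simp only [Fin.sum_univ_two, map_add, map_smul, inner_add_right, inner_smul_right, hτ]
      simp
      ring
    have := hT (fderiv ℝ (fderiv ℝ u) x τ)
    simp only [zero_smul, add_zero, hn0, ← ha]
    simp
    linarith)
  obtain ⟨hφ, hle⟩ := hcurve (fun s => x + s • τ) (fun _ => τ) (by simp)
    (Eventually.of_forall hline) (by
      filter_upwards [hne.filter_mono
          (nhdsWithin_mono 0 fun t (ht : t ∈ Ioi (0 : ℝ)) => ne_of_gt ht),
        (hlinecont.eventually hu).filter_mono nhdsWithin_le_nhds] with t ht hut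
      set y := x + t • τ
      have hb := fderiv_gradNormSq_projGradient hut.1 hut.2 ξ
      have hw := fderiv_gradNormSq_projGradient hut.1 hut.2 n
      set b := projGradient u ξ y
      set w := projGradient u n y
      -- Cramer's rule: where the determinant is nonzero, `τ` is a combination of two directions in
      -- which `|Du|²` is stationary.
      have hcomb : (b 0 * w 1 - b 1 * w 0) • τ
          = (τ 0 * w 1 - τ 1 * w 0) • b + (b 0 * τ 1 - b 1 * τ 0) • w := by
        ext i
        fin_cases i <;> simp <;> ring
      have h := congrArg (fderiv ℝ (gradNormSq u) y) hcomb
      simp only [map_add, map_smul, hb, hw, add_zero, smul_eq_mul, mul_zero] at h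
      exact (mul_eq_zero.mp h).resolve_left ht)
  have hψ := hasDerivAt_inner_sub_fderiv hux.1 (differentiableAt_const τ) (hline 0) (by simp) hn0
  have h := second_deriv_nonpos_of_eventually_le hφ
    (by simp only [zero_smul, add_zero]
        rw [← hn, ← inner_projGradient, hn0, inner_zero_left, mul_zero]) hψ hle
  rw [← hn] at h
  nlinarith [sq_nonneg ‖fderiv ℝ u x τ‖]

end ConstrainedMax

/-! ### From constrained maxima to the maximum principle -/

section MaximumPrinciple

open Filter Topology Set

variable {Ω Ω' : Set (EuclideanSpace ℝ (Fin 2))}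
  {u : EuclideanSpace ℝ (Fin 2) → EuclideanSpace ℝ (Fin 2)}

/-- A one-dimensional projection of an `∞`-harmonic map is bounded by its boundary values. -/
theorem IsInfHarmonic.inner_le_of_frontier (hu : IsInfHarmonic Ω u) (hΩ : IsOpen Ω)
    (hcomp : IsCompact (closure Ω')) (hsub : closure Ω' ⊆ Ω) (η : EuclideanSpace ℝ (Fin 2)) {m : ℝ}
    (hm : ∀ z ∈ frontier Ω', inner ℝ η (u z) ≤ m) :
    ∀ x ∈ closure Ω', inner ℝ η (u x) ≤ m := by
  by_contra! hcon
  obtain ⟨x', hx', hmx'⟩ := hcon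
  have hC2 : ∀ x ∈ Ω, ContDiffAt ℝ 2 u x := fun x hx =>
    hu.contDiffOn.contDiffAt (hΩ.mem_nhds hx)
  have hucont : ContinuousOn u (closure Ω') := hu.contDiffOn.continuousOn.mono hsub
  have hvcont : ContinuousOn (fun x => inner ℝ η (u x)) (closure Ω') :=
    continuousOn_const.inner hucont
  have hint : ∀ x ∈ closure Ω', x ∉ frontier Ω' → x ∈ interior Ω' := fun x hx hxf => by
    by_contra h
    exact hxf ⟨hx, h⟩
  have hintΩ : interior Ω' ⊆ Ω := interior_subset.trans (subset_closure.trans hsub)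
  obtain ⟨x₁, hx₁, hmx₁, hDx₁⟩ :
      ∃ x ∈ interior Ω', m < inner ℝ η (u x) ∧ fderiv ℝ u x ≠ 0 := by
    -- Otherwise `u` is locally constant wherever `⟪η, u⟫ > m` in the interior, so the set of
    -- maximum points of `⟪η, u⟫` is nonempty, compact and open, which is impossible in the plane.
    by_contra! hcrit
    obtain ⟨x₀, hx₀, hmax⟩ := hcomp.exists_isMaxOn ⟨x', hx'⟩ hvcont
    have hmx₀ : m < inner ℝ η (u x₀) := hmx'.trans_le (hmax hx')
    set S := closure Ω' ∩ (fun x => inner ℝ η (u x)) ⁻¹' Ici (inner ℝ η (u x₀)) with hS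
    have hclosed : IsClosed S := hvcont.preimage_isClosed_of_isClosed isClosed_closure isClosed_Ici
    have hopen : IsOpen S := by
      rw [isOpen_iff_mem_nhds]
      rintro x ⟨hx, hvx⟩
      have hvx' : m < inner ℝ η (u x) := hmx₀.trans_le hvx
      have hxi : x ∈ interior Ω' := hint x hx fun hxf => not_lt.mpr (hm x hxf) hvx'
      have hcx : ContinuousAt (fun x => inner ℝ η (u x)) x :=
        continuousAt_const.inner (hC2 x (hsub hx)).continuousAt
      obtain ⟨r, hr, hball⟩ := Metric.mem_nhds_iff.mp (inter_mem
        (isOpen_interior.mem_nhds hxi) (hcx.preimage_mem_nhds (Ioi_mem_nhds hvx')))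
      have hdiff : DifferentiableOn ℝ u (Metric.ball x r) := fun y hy =>
        ((hC2 y (hintΩ (hball hy).1)).differentiableAt (by norm_num)).differentiableWithinAt
      refine mem_of_superset (Metric.ball_mem_nhds x hr) fun y hy => ?_
      have huy : u y = u x := (convex_ball x r).is_const_of_fderivWithin_eq_zero (𝕜 := ℝ) hdiff
        (fun z hz => by
          rw [fderivWithin_of_isOpen Metric.isOpen_ball hz]
          exact hcrit z (hball hz).1 (hball hz).2) hy (Metric.mem_ball_self hr)
      refine ⟨subset_closure (interior_subset (hball hy).1), ?_⟩
      rw [mem_preimage, huy]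
      exact hvx
    have huniv := IsClopen.eq_univ ⟨hclosed, hopen⟩ ⟨x₀, hx₀, le_refl (inner ℝ η (u x₀))⟩
    exact noncompact_univ (EuclideanSpace ℝ (Fin 2))
      (huniv ▸ hcomp.of_isClosed_subset hclosed inter_subset_left)
  have hx₁c : x₁ ∈ closure Ω' := subset_closure (interior_subset hx₁)
  set A := closure Ω' ∩ gradNormSq u ⁻¹' {gradNormSq u x₁} with hA
  have hAcomp : IsCompact A := hcomp.of_isClosed_subset
    (ContinuousOn.preimage_isClosed_of_isClosed (fun x hx =>
      (hasFDerivAt_gradNormSq (hC2 x (hsub hx))).continuousAt.continuousWithinAt)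
      isClosed_closure isClosed_singleton) inter_subset_left
  obtain ⟨C, hC⟩ := hcomp.exists_bound_of_continuousOn hucont
  -- Large circles approximate the half-plane: `2R` times the gap is `2C² + 2`, more than the `C²`
  -- by which `‖u‖²` can favour a frontier point over `x₁`.
  set R := (C ^ 2 + 1) / (inner ℝ η (u x₁) - m) with hR
  have hgap : 0 < inner ℝ η (u x₁) - m := sub_pos.mpr hmx₁
  have hR0 : 0 < R := by positivity
  have hRgap : R * (inner ℝ η (u x₁) - m) = C ^ 2 + 1 := div_mul_cancel₀ _ hgap.ne'
  have hexpand : ∀ x, ‖u x - -(R • η)‖ ^ 2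
      = ‖u x‖ ^ 2 + 2 * (R * inner ℝ η (u x)) + ‖R • η‖ ^ 2 := fun x => by
    rw [sub_neg_eq_add, norm_add_sq_real, inner_smul_right, real_inner_comm]
  obtain ⟨x₂, hx₂, hmax₂⟩ := hAcomp.exists_isMaxOn ⟨x₁, hx₁c, rfl⟩
    (f := fun x => ‖u x - -(R • η)‖ ^ 2)
    (((hucont.mono inter_subset_left).sub continuousOn_const).norm.pow 2)
  have hx₂i : x₂ ∈ interior Ω' := by
    refine hint x₂ hx₂.1 fun hf => ?_
    have h₁ : ‖u x₁ - -(R • η)‖ ^ 2 ≤ ‖u x₂ - -(R • η)‖ ^ 2 := hmax₂ ⟨hx₁c, rfl⟩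
    rw [hexpand, hexpand] at h₁
    have h₂ : ‖u x₂‖ ^ 2 ≤ C ^ 2 := pow_le_pow_left₀ (norm_nonneg _) (hC x₂ hx₂.1) 2
    have h₃ : R * inner ℝ η (u x₂) ≤ R * m := mul_le_mul_of_nonneg_left (hm x₂ hf) hR0.le
    rw [mul_sub] at hRgap
    nlinarith [sq_nonneg ‖u x₁‖, sq_nonneg C]
  have hzero : gradNormSq u x₂ = 0 := by
    refine gradNormSq_eq_zero_of_constrained_max ?_ (-(R • η)) ?_
    · filter_upwards [hΩ.mem_nhds (hsub hx₂.1)] with y hy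
      exact ⟨hC2 y hy, hu.infLaplacian_eq_zero y hy⟩
    · filter_upwards [isOpen_interior.mem_nhds hx₂i] with y hy hgy
      exact hmax₂ ⟨subset_closure (interior_subset hy), hgy.trans hx₂.2⟩
  exact hDx₁ ((gradNormSq_eq_zero_iff u x₁).mp (hx₂.2 ▸ hzero))

lemma frontier_nonempty_of_isCompact_closure (hcomp : IsCompact (closure Ω'))
    (hne : Ω'.Nonempty) : (frontier Ω').Nonempty := by
  by_contra! h
  have huniv := (isClopen_iff_frontier_eq_empty.mpr h).eq_univ hne
  rw [huniv, closure_univ] at hcomp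
  exact noncompact_univ _ hcomp

end MaximumPrinciple

theorem corollary1p3
    (Ω : Set (EuclideanSpace ℝ (Fin 2))) (hΩ : IsOpen Ω)
    (u : EuclideanSpace ℝ (Fin 2) → EuclideanSpace ℝ (Fin 2))
    (hu : IsInfHarmonic Ω u)
    (Ω' : Set (EuclideanSpace ℝ (Fin 2)))
    (hΩ'_compact : IsCompact (closure Ω')) (hΩ'_sub : closure Ω' ⊆ Ω) :
    u '' Ω' ⊆ closure (convexHull ℝ (u '' frontier Ω')) ∧
      (Ω'.Nonempty → ∀ η : EuclideanSpace ℝ (Fin 2), ‖η‖ = 1 →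
        ∃ y ∈ frontier Ω',
          (∀ z ∈ frontier Ω', inner ℝ η (u z) ≤ inner ℝ η (u y)) ∧
            ∀ x ∈ Ω', inner ℝ η (u x) ≤ inner ℝ η (u y)) := by
  constructor
  · rintro _ ⟨x, hx, rfl⟩
    by_contra hxu
    -- The separating functional is represented by a vector `η`, not normalised, so the bound is
    -- needed for arbitrary `η`. An empty frontier is also covered.
    obtain ⟨f, m, hfm, hmx⟩ := geometric_hahn_banach_closed_point
      (convex_convexHull ℝ (u '' frontier Ω')).closure isClosed_closure hxu
    set η := (InnerProductSpace.toDual ℝ (EuclideanSpace ℝ (Fin 2))).symm f with hη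
    have hf : ∀ y, inner ℝ η y = f y := fun y => InnerProductSpace.toDual_symm_apply
    have h := hu.inner_le_of_frontier hΩ hΩ'_compact hΩ'_sub η (m := m) (fun z hz => by
      rw [hf]
      exact (hfm _ (subset_closure (subset_convexHull ℝ _ ⟨z, hz, rfl⟩))).le) x (subset_closure hx)
    rw [hf] at h
    exact absurd hmx (not_lt.mpr h)
  · intro hne η _
    have hsub : frontier Ω' ⊆ closure Ω' := frontier_subset_closure
    obtain ⟨y, hy, hmax⟩ := (hΩ'_compact.of_isClosed_subset isClosed_frontier hsub).exists_isMaxOn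
      (frontier_nonempty_of_isCompact_closure hΩ'_compact hne)
      (f := fun x => (inner ℝ η (u x) : ℝ))
      (continuousOn_const.inner (hu.contDiffOn.continuousOn.mono (hsub.trans hΩ'_sub)))
    exact ⟨y, hy, fun z hz => hmax hz, fun x hx => hu.inner_le_of_frontier hΩ hΩ'_compact hΩ'_sub η
      (fun z hz => hmax hz) x (subset_closure hx)⟩
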